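/- A rooted plane tree is a finite rooted tree in which the children of every vertex are ordered from left to right. For odd $n$ let $\mathcal{B}_n$ be the (finite) family of all plane binary trees with $n$ vertices, that is, rooted plane trees in which every vertex has $0$ or $2$ children. Regard a rooted plane tree as a poset whose maximal element is the root (ancestors are larger than their descendants). An embedding of a rooted plane tree $S$ into a rooted plane tree $T$ is a subposet of $T$ (a set of vertices of $T$ with the induced order) that is isomorphic to $S$ in such a way that the left-to-right order of the children of each vertex of $S$ is the one inherited from $T$; it is good if it contains the root of $T$. Let $a_T(S)$ and $g_T(S)$ be the numbers of all embeddings and of good embeddings of $S$ into $T$, and put $a_{\mathcal{B}_n}(S)=\sum_{T\in\mathcal{B}_n}a_T(S)$ and $g_{\mathcal{B}_n}(S)=\sum_{T\in\mathcal{B}_n}g_T(S)$. **Corollary.** Let $S$ be a rooted plane tree with $m\ge 1$ vertices and $l$ leaves, and let $k=\frac{m+l-2}{2}$. Then, as $n\to\infty$ through the odd integers, $$ \frac{g_{\mathcal{B}_n}(S)}{a_{\mathcal{B}_n}(S)}\sim \begin{cases} \dfrac{\Gamma(k+1/2)}{\Gamma(k)}\,\dfrac{\sqrt2}{\sqrt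 n} & \text{if } k>0,\\[2mm] \dfrac1n & \text{if } k=0, \end{cases} $$ where $f(n)\sim h(n)$ means $f(n)/h(n)\to 1$. In particular, for $k>0$ the ratio is of order $\Theta(1/\sqrt n)$ along odd $n$. (The case $k=0$ occurs exactly when $S$ is a single vertex, a vertex without children being counted as a leaf.) -/

import Mathlib

open Filter Asymptotics

/-- Finite rooted plane trees: a root together with the left-to-right list of the subtrees
of its children. -/
inductive PlaneTree : Type
  | node : List PlaneTree → PlaneTree

namespace PlaneTree

/-- The number of vertices. -/
def size : PlaneTree → ℕ
  | node ts => 1 + (ts.map size).sum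

/-- The entry `d_i` of the degree distribution sequence: the number of vertices with exactly `i`
children. In particular `degreeCount 0` is the number of leaves. -/
def degreeCount (i : ℕ) : PlaneTree → ℕ
  | node ts => (if ts.length = i then 1 else 0) + (ts.map (degreeCount i)).sum

/-- A vertex is addressed by the list of the (0-based) child indices on the path from the root to
it; the root has the address `[]`. -/
def IsVertex : PlaneTree → List ℕ → Prop
  | _, [] => True
  | node ts, i :: p => ∃ h : i < ts.length, IsVertex ts[i] p

/-- The vertex set of a plane tree. The vertex `p` is `q` or an ancestor of `q` exactly if `p` is a
prefix of `q`; this is the order of the tree as a poset with the root as its maximal element. -/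
def vertices (T : PlaneTree) : Set (List ℕ) := {p | T.IsVertex p}

/-- `p` lies strictly to the left of `q`: for some vertex `r`, the vertices `p` and `q` are in the
subtrees of two different children of `r`, that of `p` being further left. -/
def LeftOf (p q : List ℕ) : Prop :=
  ∃ (r : List ℕ) (a b : ℕ), a < b ∧ (r ++ [a]) <+: p ∧ (r ++ [b]) <+: q

/-- `U` is (the vertex set of) an embedding of `S` into `T`: a subposet of `T`, with the order
induced by `T`, which is isomorphic to `S` by an isomorphism under which the left-to-right order of
the children of each vertex of `S` is the one inherited from `T`. -/
def IsEmbedding (S T : PlaneTree) (U : Set (List ℕ)) : Prop :=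
  U ⊆ T.vertices ∧
    ∃ f : S.vertices ≃ U,
      (∀ p q : S.vertices, (p : List ℕ) <+: q ↔ (f p : List ℕ) <+: f q) ∧
      ∀ (p : List ℕ) (i j : ℕ) (hi : p ++ [i] ∈ S.vertices) (hj : p ++ [j] ∈ S.vertices),
        i < j → LeftOf (f ⟨p ++ [i], hi⟩) (f ⟨p ++ [j], hj⟩)

/-- `a_T(S)`, the number of embeddings of `S` into `T`. -/
noncomputable def numEmbeddings (T S : PlaneTree) : ℕ :=
  {U : Set (List ℕ) | IsEmbedding S T U}.ncard

/-- `g_T(S)`, the number of good embeddings of `S` into `T`: those that contain the root of `T`. -/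
noncomputable def numGoodEmbeddings (T S : PlaneTree) : ℕ :=
  {U : Set (List ℕ) | IsEmbedding S T U ∧ [] ∈ U}.ncard

/-- Plane binary trees: every vertex has either no child or exactly two children. -/
inductive IsBinary : PlaneTree → Prop
  | leaf : IsBinary (node [])
  | branch (L R : PlaneTree) : IsBinary L → IsBinary R → IsBinary (node [L, R])

theorem size_node (ts : List PlaneTree) : (node ts).size = 1 + (ts.map size).sum := by
  rw [size]

theorem vertices_finite : ∀ T : PlaneTree, T.vertices.Finite
  | node ts => by
    have h : ∀ i : Fin ts.length, (ts[i]).vertices.Finite := fun i => vertices_finite ts[i]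
    refine ((Set.finite_singleton ([] : List ℕ)).union
      (Set.finite_iUnion fun i : Fin ts.length => (h i).image (List.cons (i : ℕ)))).subset ?_
    rintro (_ | ⟨i, p⟩) hp
    · exact Or.inl rfl
    · obtain ⟨hi, hp⟩ := hp
      exact Or.inr (Set.mem_iUnion.2 ⟨⟨i, hi⟩, p, hp, rfl⟩)
termination_by T => sizeOf T
decreasing_by
  have := List.sizeOf_lt_of_mem (List.getElem_mem i.2)
  simp only [node.sizeOf_spec, Fin.getElem_fin]
  omega

/-- So `numEmbeddings` and `numGoodEmbeddings` count finite sets. -/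
theorem embeddings_finite (S T : PlaneTree) : {U : Set (List ℕ) | IsEmbedding S T U}.Finite :=
  T.vertices_finite.finite_subsets.subset fun _ hU => hU.1

theorem finite_binary (n : ℕ) : {T : PlaneTree | T.IsBinary ∧ T.size = n}.Finite := by
  suffices h : ∀ n : ℕ, {T : PlaneTree | T.IsBinary ∧ T.size < n}.Finite from
    (h (n + 1)).subset fun T hT => ⟨hT.1, by have := hT.2; omega⟩
  intro n
  induction n with
  | zero => exact Set.finite_empty.subset fun T hT => absurd hT.2 (Nat.not_lt_zero _)
  | succ n ih =>
    refine ((Set.finite_singleton (node [])).union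
      (Set.Finite.image2 (fun L R => node [L, R]) ih ih)).subset ?_
    rintro T ⟨hT, hs⟩
    cases hT with
    | leaf => exact Or.inl rfl
    | branch L R hL hR =>
      simp only [size_node, List.map_cons, List.map_nil, List.sum_cons, List.sum_nil] at hs
      exact Or.inr ⟨L, ⟨hL, by omega⟩, R, ⟨hR, by omega⟩, rfl⟩

/-- The family `B_n` of all plane binary trees with `n` vertices. -/
noncomputable def binaryTrees (n : ℕ) : Finset PlaneTree := (finite_binary n).toFinset

/-- The total number of embeddings of `S` into the members of `B_n`. -/
noncomputable def allCount (n : ℕ) (S : PlaneTree) : ℕ :=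
  ∑ T ∈ binaryTrees n, numEmbeddings T S

/-- The total number of good embeddings of `S` into the members of `B_n`. -/
noncomputable def goodCount (n : ℕ) (S : PlaneTree) : ℕ :=
  ∑ T ∈ binaryTrees n, numGoodEmbeddings T S

end PlaneTree

/-! Write `s = √(1 - 4X)`, with `X` marking internal vertices, and count copies of a forest `F`
rather than only of a tree. In a binary tree with root subtrees `L` and `R`, a copy of `F` avoiding
the root is a copy of an initial segment of `F` in `L` together with a copy of the rest in `R`; a
copy containing the root exists only if `F = [node G]`, and then it is the root plus such a split
copy of `G`. The split is unique because plane forests are rigid (`SameShape.forest_eq`), so counts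
become convolutions (`ncard_copyPairs`).

For generating functions, let `C` count all binary trees, so that `1 - 2XC = s`. Splits with an
empty side contribute `2XC` times the unknown series; moving them to the left produces a factor `s`.
In particular `s` times the series of all embeddings of `S` is the series of good ones
(`copySeries_mul_singleton`). Induction on forests and trees (`hasClosedForm_of_forall`,
`hasClosedForm_singleton`) gives, after multiplication by `X`, the closed forms `a (1 - s)^c (1 -
4X)^(-k)` for good and `a (1 - s)^c (1 - 4X)^(-(k + 1/2))` for all embeddings, with the same `a > 0`
and `c`.

Powers of `1 - s` do not affect the leading asymptotics (`tendsto_coeff_mul_oneSubFourPow`), so for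
`k > 0` the ratio of coefficients is governed by `n^(k-1) / Γ(k)` over `n^(k-1/2) / Γ(k + 1/2)`. For
`k = 0` the factor `1 / Γ(k)` degenerates, but `S` is a single vertex and the ratio is exactly `1 /
n`. -/

open scoped Topology PowerSeries

/-! ### Powers of `1 - 4X` and the asymptotics of their coefficients -/

/-- The formal power series `(1 - 4X) ^ (-r)`. -/
noncomputable def PowerSeries.oneSubFourPow (r : ℝ) : ℝ⟦X⟧ :=
  PowerSeries.rescale (-4 : ℝ) (PowerSeries.binomialSeries ℝ (-r))

namespace PowerSeries

theorem coeff_oneSubFourPow (r : ℝ) (n : ℕ) :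
    coeff n (oneSubFourPow r) = 4 ^ n * Ring.multichoose r n := by
  rw [oneSubFourPow, coeff_rescale, binomialSeries_coeff, Ring.choose_neg', Int.negOnePow_def,
    neg_pow]
  simp [Units.smul_def]
  ring_nf
  simp [mul_comm n 2]

theorem oneSubFourPow_add (r s : ℝ) :
    oneSubFourPow (r + s) = oneSubFourPow r * oneSubFourPow s := by
  rw [oneSubFourPow, neg_add, binomialSeries_add, map_mul, oneSubFourPow, oneSubFourPow]

theorem oneSubFourPow_zero : oneSubFourPow 0 = 1 := by
  simp [oneSubFourPow]

theorem oneSubFourPow_neg_one : oneSubFourPow (-1) = 1 - 4 * X := by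
  have h := binomialSeries_nat (R := ℝ) (A := ℝ) 1
  rw [oneSubFourPow, neg_neg, ← Nat.cast_one, h]
  have : (4 : ℝ⟦X⟧) = C (4 : ℝ) := (map_ofNat C 4).symm
  simp [rescale_X, this, sub_eq_add_neg]

theorem oneSubFourPow_half_pow (n : ℕ) : oneSubFourPow (1 / 2) ^ n = oneSubFourPow (n / 2) := by
  induction n with
  | zero => simp [oneSubFourPow_zero]
  | succ n ih =>
    rw [pow_succ, ih, ← oneSubFourPow_add]
    congr 1
    push_cast
    ring

/-- The only square root of `1 - 4X` with constant coefficient `1`. -/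
theorem eq_oneSubFourPow_neg_half {s : ℝ⟦X⟧} (hs : s ^ 2 = 1 - 4 * X)
    (h0 : constantCoeff s = 1) : s = oneSubFourPow (-1 / 2) := by
  have hsq : oneSubFourPow (-1 / 2) ^ 2 = 1 - 4 * X := by
    rw [sq, ← oneSubFourPow_add, ← oneSubFourPow_neg_one]
    norm_num
  have h : (s - oneSubFourPow (-1 / 2)) * (s + oneSubFourPow (-1 / 2)) = 0 := by
    linear_combination hs - hsq
  rcases mul_eq_zero.1 h with h | h
  · exact sub_eq_zero.1 h
  · have h1 : constantCoeff (oneSubFourPow (-1 / 2)) = 1 := by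
      rw [← coeff_zero_eq_constantCoeff_apply, coeff_oneSubFourPow]
      simp
    have := congrArg constantCoeff h
    rw [map_add, h0, h1] at this
    norm_num at this

end PowerSeries

theorem Real.multichoose_eq_prod_div (r : ℝ) (n : ℕ) :
    Ring.multichoose r n = (∏ j ∈ Finset.range n, (r + j)) / n.factorial := by
  rw [eq_div_iff (by positivity), mul_comm, ← nsmul_eq_mul,
    Ring.factorial_nsmul_multichoose_eq_ascPochhammer, Polynomial.ascPochhammer_smeval_eq_eval]
  induction n with
  | zero => simp
  | succ n ih => rw [ascPochhammer_succ_eval, ih, Finset.prod_range_succ]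

/-- At the poles of the Gamma function this says that the limit is `0`. -/
theorem Real.tendsto_multichoose_mul_rpow (r : ℝ) :
    Tendsto (fun n : ℕ => Ring.multichoose r n * (n : ℝ) ^ (1 - r)) atTop
      (𝓝 (Real.Gamma r)⁻¹) := by
  by_cases hr : ∃ m : ℕ, r = -m
  · obtain ⟨m, rfl⟩ := hr
    rw [Real.Gamma_neg_nat_eq_zero, inv_zero]
    refine tendsto_const_nhds.congr' ?_
    filter_upwards [eventually_gt_atTop m] with n hn
    -- Once `n > m`, the factor `j = m` of the rising product vanishes.
    rw [Real.multichoose_eq_prod_div,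
      Finset.prod_eq_zero (Finset.mem_range.2 hn) (by simp), zero_div, zero_mul]
  · push Not at hr
    have h1 := (Real.GammaSeq_tendsto_Gamma r).inv₀ (Real.Gamma_ne_zero hr)
    -- The product in Euler's sequence `GammaSeq` has one factor more, `r + n`, than the one in
    -- `multichoose`; this quotient makes up for it.
    have h2 : Tendsto (fun n : ℕ => (n : ℝ) / (n + r)) atTop (𝓝 1) :=
      tendsto_natCast_div_add_atTop r
    have h3 := h1.mul h2
    rw [mul_one] at h3
    refine h3.congr' ?_
    filter_upwards [eventually_gt_atTop 0] with n hn
    have hn' : (0 : ℝ) < n := Nat.cast_pos.2 hn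
    have hnr : (n : ℝ) + r ≠ 0 := fun h => hr n (by linarith)
    have hpow := (Real.rpow_pos_of_pos hn' r).ne'
    have hfac : (n.factorial : ℝ) ≠ 0 := by positivity
    rw [Real.multichoose_eq_prod_div, Real.GammaSeq, Finset.prod_range_succ, Real.rpow_sub hn',
      Real.rpow_one, inv_div, add_comm r]
    field_simp

namespace PowerSeries

/-- Expanding one factor `1 - √(1 - 4X)` gives the series for `r` minus the one for `r - 1/2`, and
the latter is smaller by `n^(-1/2)`. The induction needs all real `r`, since lowering `r` by halves
can reach the poles of the Gamma function. -/
theorem tendsto_coeff_mul_oneSubFourPow (c : ℕ) (r : ℝ) :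
    Tendsto (fun n : ℕ => coeff n ((1 - oneSubFourPow (-1 / 2)) ^ c * oneSubFourPow r) / 4 ^ n *
      (n : ℝ) ^ (1 - r)) atTop (𝓝 (Real.Gamma r)⁻¹) := by
  induction c generalizing r with
  | zero =>
    refine (Real.tendsto_multichoose_mul_rpow r).congr fun n => ?_
    rw [pow_zero, one_mul, coeff_oneSubFourPow, mul_div_cancel_left₀ _ (by positivity)]
  | succ c ih =>
    have h0 : Tendsto (fun n : ℕ => (n : ℝ) ^ (-(1 / 2) : ℝ)) atTop (𝓝 0) :=
      (tendsto_rpow_neg_atTop (by norm_num)).comp tendsto_natCast_atTop_atTop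
    have h := (ih r).sub ((ih (r - 1 / 2)).mul h0)
    rw [mul_zero, sub_zero] at h
    refine h.congr' ?_
    filter_upwards [eventually_gt_atTop 0] with n hn
    have hn' : (0 : ℝ) < n := Nat.cast_pos.2 hn
    have h1 : (1 - oneSubFourPow (-1 / 2)) ^ (c + 1) * oneSubFourPow r =
        (1 - oneSubFourPow (-1 / 2)) ^ c * oneSubFourPow r -
          (1 - oneSubFourPow (-1 / 2)) ^ c * oneSubFourPow (r - 1 / 2) := by
      rw [show r - 1 / 2 = -1 / 2 + r by ring, oneSubFourPow_add]
      ring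
    rw [h1, map_sub, mul_assoc _ ((n : ℝ) ^ _), ← Real.rpow_add hn']
    ring_nf

end PowerSeries

/-! ### The ancestor order and the left-to-right order on addresses -/

namespace PlaneTree

theorem not_leftOf_nil_left (q : List ℕ) : ¬ LeftOf [] q := by
  rintro ⟨r, a, b, -, h, -⟩
  simp at h

theorem not_leftOf_nil_right (p : List ℕ) : ¬ LeftOf p [] := by
  rintro ⟨r, a, b, -, -, h⟩
  simp at h

theorem leftOf_cons_cons {i j : ℕ} {p q : List ℕ} :
    LeftOf (i :: p) (j :: q) ↔ i < j ∨ (i = j ∧ LeftOf p q) := by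
  constructor
  · rintro ⟨_ | ⟨c, r⟩, a, b, hab, h1, h2⟩
    · simp only [List.nil_append, List.cons_prefix_cons] at h1 h2
      left
      omega
    · simp only [List.cons_append, List.cons_prefix_cons] at h1 h2
      exact Or.inr ⟨h1.1.symm.trans h2.1, r, a, b, hab, h1.2, h2.2⟩
  · rintro (h | ⟨rfl, r, a, b, hab, h1, h2⟩)
    · exact ⟨[], i, j, h, by simp, by simp⟩
    · exact ⟨i :: r, a, b, hab, by simpa using h1, by simpa using h2⟩

theorem leftOf_append_append (r : List ℕ) {p q : List ℕ} :
    LeftOf (r ++ p) (r ++ q) ↔ LeftOf p q := by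
  induction r with
  | nil => rfl
  | cons i r ih => simp [leftOf_cons_cons, ih]

theorem LeftOf.asymm {p q : List ℕ} (h : LeftOf p q) : ¬ LeftOf q p := by
  induction p generalizing q with
  | nil => exact absurd h (not_leftOf_nil_left q)
  | cons i p ih =>
    cases q with
    | nil => exact not_leftOf_nil_left _
    | cons j q =>
      rw [leftOf_cons_cons] at h ⊢
      rintro (h' | ⟨rfl, h'⟩)
      · omega
      · exact ih (h.resolve_left (lt_irrefl _)).2 h'

theorem LeftOf.not_prefix {p q : List ℕ} (h : LeftOf p q) : ¬ p <+: q ∧ ¬ q <+: p := by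
  induction p generalizing q with
  | nil => exact absurd h (not_leftOf_nil_left q)
  | cons i p ih =>
    cases q with
    | nil => exact absurd h (not_leftOf_nil_right _)
    | cons j q =>
      rw [leftOf_cons_cons] at h
      simp only [List.cons_prefix_cons]
      constructor
      · rintro ⟨rfl, h'⟩
        exact (ih (h.resolve_left (lt_irrefl _)).2).1 h'
      · rintro ⟨rfl, h'⟩
        exact (ih (h.resolve_left (lt_irrefl _)).2).2 h'

theorem LeftOf.ne {p q : List ℕ} (h : LeftOf p q) : p ≠ q := by
  rintro rfl
  exact h.not_prefix.1 List.prefix_rfl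

/-- Because these cases are exhaustive, a map that preserves and reflects ancestry and preserves
`LeftOf` also reflects `LeftOf`. -/
theorem prefix_or_leftOf (p q : List ℕ) : p <+: q ∨ q <+: p ∨ LeftOf p q ∨ LeftOf q p := by
  induction p generalizing q with
  | nil => simp
  | cons i p ih =>
    cases q with
    | nil => simp
    | cons j q =>
      simp only [List.cons_prefix_cons, leftOf_cons_cons]
      rcases lt_trichotomy i j with h | rfl | h
      · simp [h]
      · simpa using ih q
      · simp [h]

theorem LeftOf.of_prefix {p q p' q' : List ℕ} (h : LeftOf p q) (hp : p <+: p') (hq : q <+: q') :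
    LeftOf p' q' := by
  obtain ⟨r, a, b, hab, h1, h2⟩ := h
  exact ⟨r, a, b, hab, h1.trans hp, h2.trans hq⟩

theorem _root_.List.IsPrefix.antisymm {α : Type*} {p q : List α} (h : p <+: q) (h' : q <+: p) :
    p = q :=
  h.eq_of_length_le h'.length_le

/-! ### Isomorphism of sets of addresses -/

/-- Two sets of addresses are isomorphic with respect to the ancestor order and the left-to-right
order. The map is automatically injective on `A`. -/
def SameShape (A B : Set (List ℕ)) : Prop :=
  ∃ f : List ℕ → List ℕ, f '' A = B ∧
    ∀ p ∈ A, ∀ q ∈ A, (p <+: q ↔ f p <+: f q) ∧ (LeftOf p q ↔ LeftOf (f p) (f q))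

theorem SameShape.trans {A B C : Set (List ℕ)} (h : SameShape A B) (h' : SameShape B C) :
    SameShape A C := by
  obtain ⟨f, rfl, hf⟩ := h
  obtain ⟨g, rfl, hg⟩ := h'
  refine ⟨g ∘ f, Set.image_comp g f A, fun p hp q hq => ?_⟩
  have h1 := hf p hp q hq
  have h2 := hg _ (Set.mem_image_of_mem f hp) _ (Set.mem_image_of_mem f hq)
  exact ⟨h1.1.trans h2.1, h1.2.trans h2.2⟩

theorem SameShape.refl (A : Set (List ℕ)) : SameShape A A :=
  ⟨id, Set.image_id A, fun _ _ _ _ => ⟨Iff.rfl, Iff.rfl⟩⟩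

theorem SameShape.symm {A B : Set (List ℕ)} (h : SameShape A B) : SameShape B A := by
  obtain ⟨f, rfl, hf⟩ := h
  have hinj : Set.InjOn f A := fun p hp q hq h =>
    ((hf p hp q hq).1.2 (h ▸ List.prefix_rfl)).antisymm
      ((hf q hq p hp).1.2 (h ▸ List.prefix_rfl))
  refine ⟨Function.invFunOn f A, ?_, ?_⟩
  · rw [hinj.invFunOn_image subset_rfl]
  · rintro _ ⟨p, hp, rfl⟩ _ ⟨q, hq, rfl⟩
    rw [hinj.leftInvOn_invFunOn hp, hinj.leftInvOn_invFunOn hq]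
    exact ⟨(hf p hp q hq).1.symm, (hf p hp q hq).2.symm⟩

theorem sameShape_cons (i : ℕ) (A : Set (List ℕ)) : SameShape A (List.cons i '' A) :=
  ⟨List.cons i, rfl, fun p _ q _ => by simp [leftOf_cons_cons]⟩

theorem SameShape.insert_nil {A B : Set (List ℕ)} (h : SameShape A B) (hA : [] ∉ A)
    (hB : [] ∉ B) : SameShape (insert [] A) (insert [] B) := by
  classical
  obtain ⟨f, rfl, hf⟩ := h
  have hne : ∀ p ∈ A, p ≠ [] := fun p hp h => hA (h ▸ hp)
  have hfne : ∀ p ∈ A, f p ≠ [] := fun p hp h => hB ⟨p, hp, h⟩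
  refine ⟨fun p => if p = [] then [] else f p, ?_, ?_⟩
  · rw [Set.image_insert_eq, if_pos rfl]
    congr 1
    exact Set.image_congr fun p hp => if_neg (hne p hp)
  · rintro p (rfl | hp) q (rfl | hq)
    · simp
    · simp [not_leftOf_nil_left]
    · simp [hne p hp, hfne p hp, not_leftOf_nil_right]
    · simpa [hne p hp, hne q hq] using hf p hp q hq

theorem SameShape.union {A B A' B' : Set (List ℕ)} (hA : SameShape A A') (hB : SameShape B B')
    (h : ∀ p ∈ A, ∀ q ∈ B, LeftOf p q) (h' : ∀ p ∈ A', ∀ q ∈ B', LeftOf p q) :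
    SameShape (A ∪ B) (A' ∪ B') := by
  classical
  obtain ⟨f, rfl, hf⟩ := hA
  obtain ⟨g, rfl, hg⟩ := hB
  have hBA : ∀ q ∈ B, q ∉ A := fun q hq hqA => (h q hqA q hq).ne rfl
  have hl : ∀ p ∈ A, (if p ∈ A then f p else g p) = f p := fun p hp => if_pos hp
  have hr : ∀ q ∈ B, (if q ∈ A then f q else g q) = g q := fun q hq => if_neg (hBA q hq)
  refine ⟨fun p => if p ∈ A then f p else g p, ?_, ?_⟩
  · rw [Set.image_union, Set.image_congr hl, Set.image_congr hr]
  · have key : ∀ p ∈ A, ∀ q ∈ B, LeftOf p q ∧ LeftOf (f p) (g q) := fun p hp q hq =>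
      ⟨h p hp q hq, h' _ (Set.mem_image_of_mem f hp) _ (Set.mem_image_of_mem g hq)⟩
    rintro p (hp | hp) q (hq | hq)
    · simpa only [hl p hp, hl q hq] using hf p hp q hq
    · obtain ⟨h1, h2⟩ := key p hp q hq
      simp only [hl p hp, hr q hq, h1, h2, h1.not_prefix, h2.not_prefix, iff_self, and_self]
    · obtain ⟨h1, h2⟩ := key q hq p hp
      simp only [hr p hp, hl q hq, h1.asymm, h2.asymm, h1.not_prefix, h2.not_prefix, iff_self,
        and_self]
    · simpa only [hr p hp, hr q hq] using hg p hp q hq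

/-! ### Vertex sets of forests and their concatenation -/

/-- The addresses of the vertices of a forest: the non-root vertices of the tree obtained by adding
a common root. -/
def forestVertices (ts : List PlaneTree) : Set (List ℕ) :=
  {p | p ≠ [] ∧ (node ts).IsVertex p}

theorem isVertex_nil (T : PlaneTree) : T.IsVertex [] := by
  rw [IsVertex]
  trivial

theorem isVertex_node_cons {ts : List PlaneTree} {i : ℕ} {p : List ℕ} :
    (node ts).IsVertex (i :: p) ↔ ∃ h : i < ts.length, ts[i].IsVertex p := by
  rw [IsVertex]

theorem cons_mem_forestVertices {ts : List PlaneTree} {i : ℕ} {p : List ℕ} :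
    i :: p ∈ forestVertices ts ↔ ∃ h : i < ts.length, ts[i].IsVertex p := by
  rw [← isVertex_node_cons]
  simp [forestVertices]

theorem nil_notMem_forestVertices (ts : List PlaneTree) : [] ∉ forestVertices ts :=
  fun h => h.1 rfl

theorem vertices_node (ts : List PlaneTree) :
    (node ts).vertices = insert [] (forestVertices ts) := by
  ext p
  rcases eq_or_ne p [] with rfl | hp
  · simp [vertices, isVertex_nil]
  · simp [vertices, forestVertices, hp]

theorem forestVertices_nil : forestVertices [] = ∅ := by
  ext p
  cases p with
  | nil => simp [nil_notMem_forestVertices]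
  | cons i p => simp [cons_mem_forestVertices]

theorem forestVertices_singleton (T : PlaneTree) :
    forestVertices [T] = List.cons 0 '' T.vertices := by
  ext p
  cases p with
  | nil => simp [nil_notMem_forestVertices]
  | cons i p =>
    rw [cons_mem_forestVertices]
    constructor
    · rintro ⟨hi, hp⟩
      obtain rfl : i = 0 := by simpa using hi
      exact ⟨p, hp, rfl⟩
    · rintro ⟨q, hq, h⟩
      obtain ⟨rfl, rfl⟩ := List.cons.inj h
      exact ⟨by simp, hq⟩

theorem forestVertices_pair (L R : PlaneTree) :
    forestVertices [L, R] = List.cons 0 '' L.vertices ∪ List.cons 1 '' R.vertices := by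
  ext p
  cases p with
  | nil => simp [nil_notMem_forestVertices]
  | cons i p =>
    rw [cons_mem_forestVertices]
    constructor
    · rintro ⟨hi, hp⟩
      match i, hi, hp with
      | 0, _, hp => exact Or.inl ⟨p, hp, rfl⟩
      | 1, _, hp => exact Or.inr ⟨p, hp, rfl⟩
    · rintro (⟨q, hq, h⟩ | ⟨q, hq, h⟩)
      · obtain ⟨rfl, rfl⟩ := List.cons.inj h
        exact ⟨by simp, hq⟩
      · obtain ⟨rfl, rfl⟩ := List.cons.inj h
        exact ⟨by simp, hq⟩

/-- Move a forest to the right by `k` places. -/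
def shiftRoot (k : ℕ) : List ℕ → List ℕ
  | [] => []
  | i :: p => (i + k) :: p

theorem forestVertices_append (as bs : List PlaneTree) :
    forestVertices (as ++ bs) =
      forestVertices as ∪ shiftRoot as.length '' forestVertices bs := by
  ext p
  cases p with
  | nil =>
    simp only [nil_notMem_forestVertices, false_iff, Set.mem_union, false_or]
    rintro ⟨_ | ⟨i, q⟩, hq, h⟩
    · exact nil_notMem_forestVertices _ hq
    · exact absurd h (List.cons_ne_nil _ _)
  | cons i p =>
    rw [cons_mem_forestVertices, Set.mem_union, cons_mem_forestVertices]
    constructor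
    · rintro ⟨hi, hp⟩
      by_cases hia : i < as.length
      · rw [List.getElem_append_left hia] at hp
        exact Or.inl ⟨hia, hp⟩
      · rw [List.getElem_append_right (not_lt.1 hia)] at hp
        rw [List.length_append] at hi
        refine Or.inr ⟨(i - as.length) :: p, cons_mem_forestVertices.2 ⟨by omega, hp⟩, ?_⟩
        simp only [shiftRoot, List.cons.injEq, and_true]
        omega
    · rintro (⟨hi, hp⟩ | ⟨_ | ⟨j, q⟩, hq, h⟩)
      · refine ⟨by rw [List.length_append]; omega, ?_⟩
        rwa [List.getElem_append_left hi]
      · exact absurd h.symm (List.cons_ne_nil _ _)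
      · obtain ⟨rfl, rfl⟩ := List.cons.inj h
        obtain ⟨hj, hq⟩ := cons_mem_forestVertices.1 hq
        refine ⟨by rw [List.length_append]; omega, ?_⟩
        rw [List.getElem_append_right (Nat.le_add_left _ _)]
        simpa using hq

theorem sameShape_shiftRoot (k : ℕ) (ts : List PlaneTree) :
    SameShape (forestVertices ts) (shiftRoot k '' forestVertices ts) := by
  refine ⟨shiftRoot k, rfl, ?_⟩
  rintro (_ | ⟨i, p⟩) hp (_ | ⟨j, q⟩) hq
  · exact absurd hp (nil_notMem_forestVertices _)
  · exact absurd hp (nil_notMem_forestVertices _)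
  · exact absurd hq (nil_notMem_forestVertices _)
  · simp [shiftRoot, leftOf_cons_cons]

theorem leftOf_of_mem_shiftRoot {as bs : List PlaneTree} {p q : List ℕ}
    (hp : p ∈ forestVertices as) (hq : q ∈ shiftRoot as.length '' forestVertices bs) :
    LeftOf p q := by
  obtain ⟨q, hq, rfl⟩ := hq
  cases p with
  | nil => exact absurd hp (nil_notMem_forestVertices _)
  | cons i p =>
    cases q with
    | nil => exact absurd hq (nil_notMem_forestVertices _)
    | cons j q =>
      obtain ⟨hi, -⟩ := cons_mem_forestVertices.1 hp
      exact leftOf_cons_cons.2 (Or.inl (by omega))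

theorem SameShape.append {as bs : List PlaneTree} {A B : Set (List ℕ)}
    (hA : SameShape (forestVertices as) A) (hB : SameShape (forestVertices bs) B)
    (h : ∀ p ∈ A, ∀ q ∈ B, LeftOf p q) : SameShape (forestVertices (as ++ bs)) (A ∪ B) := by
  rw [forestVertices_append]
  exact hA.union ((sameShape_shiftRoot _ _).symm.trans hB)
    (fun p hp q hq => leftOf_of_mem_shiftRoot hp hq) h

theorem IsVertex.of_prefix {T : PlaneTree} {p q : List ℕ} (hq : T.IsVertex q) (h : p <+: q) :
    T.IsVertex p := by
  induction p generalizing T q with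
  | nil => exact isVertex_nil T
  | cons i p ih =>
    obtain ⟨ts⟩ := T
    cases q with
    | nil => simp at h
    | cons j q =>
      obtain ⟨rfl, hpq⟩ := List.cons_prefix_cons.1 h
      obtain ⟨hi, hq⟩ := isVertex_node_cons.1 hq
      exact isVertex_node_cons.2 ⟨hi, ih hq hpq⟩

theorem IsVertex.sibling {T : PlaneTree} {q : List ℕ} {i a : ℕ} (h : T.IsVertex (q ++ [i]))
    (ha : a ≤ i) : T.IsVertex (q ++ [a]) := by
  induction q generalizing T with
  | nil =>
    obtain ⟨ts⟩ := T
    obtain ⟨hi, -⟩ := isVertex_node_cons.1 h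
    exact isVertex_node_cons.2 ⟨by omega, isVertex_nil _⟩
  | cons j q ih =>
    obtain ⟨ts⟩ := T
    obtain ⟨hj, h⟩ := isVertex_node_cons.1 h
    exact isVertex_node_cons.2 ⟨hj, ih h⟩

theorem eq_append_cons_of_prefix {α : Type*} {q x : List α} (h : q <+: x) (hne : x ≠ q) :
    ∃ a w, x = q ++ a :: w := by
  obtain ⟨_ | ⟨a, w⟩, rfl⟩ := h
  · simp at hne
  · exact ⟨a, w, rfl⟩

theorem prefix_append_cons {α : Type*} (q : List α) (a : α) (w : List α) :
    q ++ [a] <+: q ++ a :: w :=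
  ⟨w, by simp⟩

/-! ### Rigidity of plane forests -/

/-- A plane forest has no isomorphisms other than the identity. -/
theorem forestVertices_rigid {as bs : List PlaneTree} {f : List ℕ → List ℕ}
    (hfB : f '' forestVertices as = forestVertices bs)
    (hf : ∀ p ∈ forestVertices as, ∀ q ∈ forestVertices as,
      (p <+: q ↔ f p <+: f q) ∧ (LeftOf p q ↔ LeftOf (f p) (f q))) :
    ∀ p ∈ forestVertices as, f p = p := by
  have hinj : Set.InjOn f (forestVertices as) := fun p hp q hq h =>
    ((hf p hp q hq).1.2 (h ▸ List.prefix_rfl)).antisymm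
      ((hf q hq p hp).1.2 (h ▸ List.prefix_rfl))
  have hmaps : ∀ p ∈ forestVertices as, f p ∈ forestVertices bs := fun p hp =>
    hfB ▸ Set.mem_image_of_mem f hp
  intro p
  -- The outer induction fixes the parent `q`, the inner one the siblings to the left of the `i`-th
  -- child.
  induction p using List.reverseRecOn with
  | nil => exact fun h => absurd h (nil_notMem_forestVertices _)
  | append_singleton q i ihq =>
    -- The parent is fixed by `f` if it belongs to the forest; if `q = []` it does not, but then the
    -- claim is trivial.
    have hqpre : ∀ x ∈ forestVertices as, q ++ [i] ∈ forestVertices as →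
        (q <+: x ↔ q <+: f x) := by
      intro x hx hp
      rcases eq_or_ne q [] with rfl | hq
      · simp
      · have hqA : q ∈ forestVertices as := ⟨hq, hp.2.of_prefix (List.prefix_append _ _)⟩
        rw [(hf q hqA x hx).1, ihq hqA]
    have hqne : ∀ x ∈ forestVertices as, q ++ [i] ∈ forestVertices as →
        (x ≠ q ↔ f x ≠ q) := by
      intro x hx hp
      rcases eq_or_ne q [] with rfl | hq
      · exact iff_of_true hx.1 (hmaps x hx).1
      · have hqA : q ∈ forestVertices as := ⟨hq, hp.2.of_prefix (List.prefix_append _ _)⟩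
        refine not_congr ⟨?_, fun h => hinj hx hqA (h.trans (ihq hqA).symm)⟩
        rintro rfl
        exact ihq hqA
    induction i using Nat.strong_induction_on with
    | _ i ih =>
    intro hp
    have hpq : q ++ [i] ≠ q := by simp
    obtain ⟨j, w, hfp⟩ := eq_append_cons_of_prefix
      ((hqpre _ hp hp).1 (List.prefix_append _ _)) ((hqne _ hp hp).1 hpq)
    have ih' : ∀ a < i, f (q ++ [a]) = q ++ [a] := fun a ha =>
      have haA : q ++ [a] ∈ forestVertices as := ⟨by simp, hp.2.sibling ha.le⟩
      ih a ha (fun x hx _ => hqpre x hx hp) (fun x hx _ => hqne x hx hp) haA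
    have haA : ∀ a ≤ i, q ++ [a] ∈ forestVertices as := fun a ha => ⟨by simp, hp.2.sibling ha⟩
    have hfpB := hmaps _ hp
    have hjB : q ++ [j] ∈ forestVertices bs :=
      ⟨by simp, hfpB.2.of_prefix (hfp ▸ prefix_append_cons q j w)⟩
    -- A preimage of `q ++ [j]` lies strictly below `q` and weakly above `q ++ [i]`, so it is `q ++
    -- [i]` itself.
    have hfj : f (q ++ [i]) = q ++ [j] := by
      obtain ⟨x, hx, hxj⟩ := hfB.symm ▸ hjB
      have hqx : q <+: x := (hqpre x hx hp).2 (hxj ▸ List.prefix_append _ _)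
      have hxq : x ≠ q := (hqne x hx hp).2 (by rw [hxj]; simp)
      have hxp : x <+: q ++ [i] :=
        (hf x hx _ hp).1.2 (by rw [hxj, hfp]; exact prefix_append_cons q j w)
      obtain ⟨a, v, rfl⟩ := eq_append_cons_of_prefix hqx hxq
      rw [List.prefix_append_right_inj, List.cons_prefix_cons, List.prefix_nil] at hxp
      obtain ⟨rfl, rfl⟩ := hxp
      exact hxj
    rw [hfj]
    -- If `j < i`, injectivity fails, as `q ++ [j]` is already fixed. If `j > i`, a preimage of `q
    -- ++ [i]` would lie at or below some fixed sibling `q ++ [a]` with `a < i`, forcing `q ++ [a]`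
    -- to be a prefix of `q ++ [i]`.
    rcases lt_trichotomy j i with h | rfl | h
    · have := hinj (haA j h.le) hp ((ih' j h).trans hfj.symm)
      simp only [List.append_cancel_left_eq, List.cons.injEq, and_true] at this
      omega
    · rfl
    · have hiB : q ++ [i] ∈ forestVertices bs := ⟨by simp, hjB.2.sibling h.le⟩
      obtain ⟨x, hx, hxi⟩ := hfB.symm ▸ hiB
      have hqx : q <+: x := (hqpre x hx hp).2 (hxi ▸ List.prefix_append _ _)
      have hxq : x ≠ q := (hqne x hx hp).2 (by rw [hxi]; simp)
      have hxp : LeftOf x (q ++ [i]) := (hf x hx _ hp).2.2 (by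
        rw [hxi, hfj, leftOf_append_append, leftOf_cons_cons]
        exact Or.inl h)
      obtain ⟨a, v, rfl⟩ := eq_append_cons_of_prefix hqx hxq
      rw [leftOf_append_append, leftOf_cons_cons] at hxp
      have hai := hxp.resolve_right fun h => not_leftOf_nil_right _ h.2
      have h1 := (hf _ (haA a hai.le) _ hx).1.1 (prefix_append_cons q a v)
      rw [ih' a hai, hxi, List.prefix_append_right_inj, List.cons_prefix_cons] at h1
      omega

theorem vertices_injective : ∀ S T : PlaneTree, S.vertices = T.vertices → S = T
  | node as, node bs, h => by
    have hmem : ∀ i p, (∃ hi : i < as.length, as[i].IsVertex p) ↔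
        ∃ hi : i < bs.length, bs[i].IsVertex p := fun i p => by
      rw [← isVertex_node_cons, ← isVertex_node_cons]
      exact Set.ext_iff.1 h (i :: p)
    have hlt : ∀ i, i < as.length ↔ i < bs.length := fun i => by
      simpa [isVertex_nil] using hmem i []
    have hlen : as.length = bs.length :=
      le_antisymm (not_lt.1 fun h => lt_irrefl _ ((hlt _).1 h))
        (not_lt.1 fun h => lt_irrefl _ ((hlt _).2 h))
    congr 1
    refine List.ext_getElem hlen fun i h1 h2 => vertices_injective _ _ ?_
    ext p
    simpa [h1, h2, vertices] using hmem i p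
termination_by S => sizeOf S
decreasing_by
  have := List.sizeOf_lt_of_mem (List.getElem_mem h1)
  simp only [node.sizeOf_spec]
  omega

/-- By rigidity the isomorphism is the identity, and a tree is determined by its set of addresses.
-/
theorem SameShape.forest_eq {as bs : List PlaneTree}
    (h : SameShape (forestVertices as) (forestVertices bs)) : as = bs := by
  obtain ⟨f, hfB, hf⟩ := h
  have h : forestVertices as = forestVertices bs := by
    rw [← hfB, Set.image_congr (forestVertices_rigid hfB hf), Set.image_id']
  exact node.inj (vertices_injective (node as) (node bs) (by
    rw [vertices_node, vertices_node, h]))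

/-- An embedding only has to respect the order of siblings, but two vertices related by `LeftOf`
descend from two such siblings, so preservation of ancestry extends this to all pairs. Passing to
the one-tree forest `[S]` lets trees and forests be counted alike. -/
theorem isEmbedding_iff {S T : PlaneTree} {U : Set (List ℕ)} :
    IsEmbedding S T U ↔ U ⊆ T.vertices ∧ SameShape (forestVertices [S]) U := by
  classical
  rw [IsEmbedding, forestVertices_singleton]
  refine and_congr_right fun _ => ⟨?_, fun h => ?_⟩
  · rintro ⟨f, hpre, hleft⟩
    refine (sameShape_cons 0 S.vertices).symm.trans
      ⟨fun p => if h : p ∈ S.vertices then f ⟨p, h⟩ else [], ?_, ?_⟩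
    · ext u
      constructor
      · rintro ⟨p, hp, rfl⟩
        simp [hp]
      · intro hu
        refine ⟨f.symm ⟨u, hu⟩, (f.symm ⟨u, hu⟩).2, ?_⟩
        simp
    · have hl : ∀ p (hp : p ∈ S.vertices) q (hq : q ∈ S.vertices), LeftOf p q →
          LeftOf (f ⟨p, hp⟩) (f ⟨q, hq⟩) := by
        rintro p hp q hq ⟨r, a, b, hab, h1, h2⟩
        have ha : r ++ [a] ∈ S.vertices := hp.of_prefix h1
        have hb : r ++ [b] ∈ S.vertices := hq.of_prefix h2
        exact (hleft r a b ha hb hab).of_prefix ((hpre ⟨_, ha⟩ ⟨p, hp⟩).1 h1)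
          ((hpre ⟨_, hb⟩ ⟨q, hq⟩).1 h2)
      intro p hp q hq
      simp only [hp, hq, dif_pos]
      refine ⟨hpre ⟨p, hp⟩ ⟨q, hq⟩, hl p hp q hq, fun h => ?_⟩
      rcases prefix_or_leftOf p q with h' | h' | h' | h'
      · exact absurd ((hpre ⟨p, hp⟩ ⟨q, hq⟩).1 h') h.not_prefix.1
      · exact absurd ((hpre ⟨q, hq⟩ ⟨p, hp⟩).1 h') h.not_prefix.2
      · exact h'
      · exact absurd (hl q hq p hp h') h.asymm
  · obtain ⟨f, rfl, hf⟩ := (sameShape_cons 0 S.vertices).trans h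
    have hinj : Set.InjOn f S.vertices := fun p hp q hq h =>
      ((hf p hp q hq).1.2 (h ▸ List.prefix_rfl)).antisymm
        ((hf q hq p hp).1.2 (h ▸ List.prefix_rfl))
    refine ⟨Equiv.Set.imageOfInjOn f S.vertices hinj, fun p q => (hf p p.2 q q.2).1,
      fun p i j hi hj hij => (hf _ hi _ hj).2.1 ?_⟩
    rw [leftOf_append_append, leftOf_cons_cons]
    exact Or.inl hij

end PlaneTree

/-! ### Copies of forests in a binary tree, split at the root -/

namespace PlaneTree

/-- The sets of vertices of `T` that form a copy of the forest `F`. -/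
def copies (T : PlaneTree) (F : List PlaneTree) : Set (Set (List ℕ)) :=
  {U | U ⊆ T.vertices ∧ SameShape (forestVertices F) U}

theorem copies_finite (T : PlaneTree) (F : List PlaneTree) : (T.copies F).Finite :=
  T.vertices_finite.finite_subsets.subset fun _ hU => hU.1

/-- The number of copies of the forest `F` in `T`. -/
noncomputable def copyCount (T : PlaneTree) (F : List PlaneTree) : ℕ := (T.copies F).ncard

theorem numEmbeddings_eq (T S : PlaneTree) : numEmbeddings T S = T.copyCount [S] :=
  congrArg Set.ncard (Set.ext fun _ => isEmbedding_iff)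

theorem numGoodEmbeddings_eq (T S : PlaneTree) :
    numGoodEmbeddings T S = {U ∈ T.copies [S] | [] ∈ U}.ncard :=
  congrArg Set.ncard (Set.ext fun _ => and_congr_left' isEmbedding_iff)

theorem copyCount_eq_add (T : PlaneTree) (F : List PlaneTree) :
    T.copyCount F = {U ∈ T.copies F | [] ∉ U}.ncard + {U ∈ T.copies F | [] ∈ U}.ncard := by
  rw [add_comm, copyCount, ← Set.ncard_inter_add_ncard_sdiff_eq_ncard (T.copies F) {U | [] ∈ U}
    (T.copies_finite F)]
  rfl

/-- The union of copies of `V` and `W` below the two children of the root. -/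
def join (V W : Set (List ℕ)) : Set (List ℕ) := List.cons 0 '' V ∪ List.cons 1 '' W

theorem nil_notMem_join (V W : Set (List ℕ)) : [] ∉ join V W := by
  simp [join]

theorem zero_cons_mem_join {V W : Set (List ℕ)} {p : List ℕ} : 0 :: p ∈ join V W ↔ p ∈ V := by
  simp [join]

theorem one_cons_mem_join {V W : Set (List ℕ)} {p : List ℕ} : 1 :: p ∈ join V W ↔ p ∈ W := by
  simp [join]

theorem join_inj {V W V' W' : Set (List ℕ)} (h : join V W = join V' W') : V = V' ∧ W = W' := by
  constructor <;> ext p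
  · rw [← zero_cons_mem_join (W := W), h, zero_cons_mem_join]
  · rw [← one_cons_mem_join (V := V), h, one_cons_mem_join]

theorem vertices_pair (L R : PlaneTree) :
    (node [L, R]).vertices = insert [] (join L.vertices R.vertices) := by
  rw [vertices_node, forestVertices_pair, join]

theorem vertices_leaf : (node []).vertices = {[]} := by
  rw [vertices_node, forestVertices_nil, insert_empty_eq]

theorem join_subset_vertices {L R : PlaneTree} {V W : Set (List ℕ)} (hV : V ⊆ L.vertices)
    (hW : W ⊆ R.vertices) : join V W ⊆ (node [L, R]).vertices := by
  rw [vertices_pair]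
  exact (Set.union_subset_union (Set.image_mono hV) (Set.image_mono hW)).trans
    (Set.subset_insert _ _)

theorem insert_join_subset_vertices {L R : PlaneTree} {V W : Set (List ℕ)} (hV : V ⊆ L.vertices)
    (hW : W ⊆ R.vertices) : insert [] (join V W) ⊆ (node [L, R]).vertices :=
  Set.insert_subset (isVertex_nil (node [L, R])) (join_subset_vertices hV hW)

theorem exists_eq_join {L R : PlaneTree} {U : Set (List ℕ)} (hU : U ⊆ (node [L, R]).vertices)
    (h0 : [] ∉ U) : ∃ V W, V ⊆ L.vertices ∧ W ⊆ R.vertices ∧ U = join V W := by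
  rw [vertices_pair, Set.subset_insert_iff_of_notMem h0] at hU
  refine ⟨{p | 0 :: p ∈ U}, {p | 1 :: p ∈ U}, fun p hp => zero_cons_mem_join.1 (hU hp),
    fun p hp => one_cons_mem_join.1 (hU hp), ?_⟩
  ext u
  constructor
  · intro hu
    rcases hU hu with ⟨p, hp, rfl⟩ | ⟨p, hp, rfl⟩
    · exact zero_cons_mem_join.2 hu
    · exact one_cons_mem_join.2 hu
  · rintro (⟨p, hp, rfl⟩ | ⟨p, hp, rfl⟩) <;> exact hp

theorem exists_eq_insert_join {L R : PlaneTree} {U : Set (List ℕ)}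
    (hU : U ⊆ (node [L, R]).vertices) (h0 : [] ∈ U) :
    ∃ V W, V ⊆ L.vertices ∧ W ⊆ R.vertices ∧ U = insert [] (join V W) := by
  obtain ⟨V, W, hV, hW, h⟩ :=
    exists_eq_join (U := U \ {[]}) (Set.sdiff_subset.trans hU) (fun h => h.2 rfl)
  refine ⟨V, W, hV, hW, ?_⟩
  rw [← h, Set.insert_sdiff_singleton, Set.insert_eq_of_mem h0]

theorem SameShape.join {F G : List PlaneTree} {V W : Set (List ℕ)}
    (hV : SameShape (forestVertices F) V) (hW : SameShape (forestVertices G) W) :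
    SameShape (forestVertices (F ++ G)) (join V W) := by
  refine (hV.trans (sameShape_cons 0 V)).append (hW.trans (sameShape_cons 1 W)) ?_
  rintro _ ⟨p, -, rfl⟩ _ ⟨q, -, rfl⟩
  exact leftOf_cons_cons.2 (Or.inl one_pos)

theorem SameShape.insert_root {F : List PlaneTree} {U : Set (List ℕ)}
    (h : SameShape (forestVertices F) U) (h0 : [] ∉ U) :
    SameShape (forestVertices [node F]) (insert [] U) := by
  rw [forestVertices_singleton, vertices_node]
  exact (sameShape_cons 0 _).symm.trans (h.insert_nil (nil_notMem_forestVertices F) h0)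

theorem sameShape_forestVertices_nil : SameShape (forestVertices []) ∅ := by
  rw [forestVertices_nil]
  exact SameShape.refl ∅

theorem sameShape_forestVertices_leaf : SameShape (forestVertices [node []]) {[]} := by
  rw [← insert_empty_eq]
  exact sameShape_forestVertices_nil.insert_root (Set.notMem_empty _)

/-- By induction on `T`: parts in the two subtrees concatenate, and the root, if present, turns the
resulting forest into a single tree. -/
theorem IsBinary.exists_sameShape {T : PlaneTree} (hT : T.IsBinary) :
    ∀ U ⊆ T.vertices, ∃ F, SameShape (forestVertices F) U := by
  induction hT with
  | leaf =>
    intro U hU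
    rw [vertices_leaf, Set.subset_singleton_iff_eq] at hU
    rcases hU with rfl | rfl
    · exact ⟨_, sameShape_forestVertices_nil⟩
    · exact ⟨_, sameShape_forestVertices_leaf⟩
  | branch L R _ _ ihL ihR =>
    intro U hU
    by_cases h0 : [] ∈ U
    · obtain ⟨V, W, hV, hW, rfl⟩ := exists_eq_insert_join hU h0
      obtain ⟨F, hF⟩ := ihL V hV
      obtain ⟨G, hG⟩ := ihR W hW
      exact ⟨_, (hF.join hG).insert_root (nil_notMem_join V W)⟩
    · obtain ⟨V, W, hV, hW, rfl⟩ := exists_eq_join hU h0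
      obtain ⟨F, hF⟩ := ihL V hV
      obtain ⟨G, hG⟩ := ihR W hW
      exact ⟨_, hF.join hG⟩

/-- The number of copies of `F` in the forest consisting of `L` and `R`. -/
noncomputable def splitCount (L R : PlaneTree) (F : List PlaneTree) : ℕ :=
  ∑ i ∈ Finset.range (F.length + 1), L.copyCount (F.take i) * R.copyCount (F.drop i)

/-- The pairs of subsets of `L` and `R` that together form a copy of the forest `F`. -/
def copyPairs (L R : PlaneTree) (F : List PlaneTree) : Set (Set (List ℕ) × Set (List ℕ)) :=
  {x | x.1 ⊆ L.vertices ∧ x.2 ⊆ R.vertices ∧ SameShape (forestVertices F) (join x.1 x.2)}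

/-- The two halves have shapes `G` and `H`, and rigidity gives `F = G ++ H`, so a pair amounts to a
cut position and two independent copies. -/
theorem ncard_copyPairs {L R : PlaneTree} (hL : L.IsBinary) (hR : R.IsBinary)
    (F : List PlaneTree) : (copyPairs L R F).ncard = splitCount L R F := by
  classical
  have h : copyPairs L R F = ((Finset.range (F.length + 1)).biUnion fun i =>
      (L.copies_finite (F.take i)).toFinset ×ˢ (R.copies_finite (F.drop i)).toFinset :
        Finset (Set (List ℕ) × Set (List ℕ))) := by
    ext ⟨V, W⟩
    simp only [copyPairs, copies, Set.mem_ofPred_eq, Finset.coe_biUnion, Set.mem_iUnion,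
      Finset.mem_coe, Finset.mem_range, Finset.mem_product, Set.Finite.mem_toFinset, exists_prop]
    constructor
    · rintro ⟨hV, hW, h⟩
      obtain ⟨G, hG⟩ := hL.exists_sameShape V hV
      obtain ⟨H, hH⟩ := hR.exists_sameShape W hW
      obtain rfl := (h.trans (hG.join hH).symm).forest_eq
      exact ⟨G.length, by simp, ⟨hV, by simpa using hG⟩, hW, by simpa using hH⟩
    · rintro ⟨i, -, ⟨hV, hG⟩, hW, hH⟩
      refine ⟨hV, hW, ?_⟩
      simpa using hG.join hH
  rw [h, Set.ncard_coe_finset, Finset.card_biUnion, splitCount]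
  · refine Finset.sum_congr rfl fun i _ => ?_
    rw [Finset.card_product, ← Set.ncard_eq_toFinset_card _ (L.copies_finite _),
      ← Set.ncard_eq_toFinset_card _ (R.copies_finite _),
      copyCount, copyCount]
  -- The cut position is determined by the pair: the same set in `L` cannot be a copy of initial
  -- segments of different lengths.
  · intro i hi j hj hij
    rw [Function.onFun, Finset.disjoint_left]
    rintro ⟨V, W⟩ h1 h2
    simp only [copies, Finset.mem_product, Set.Finite.mem_toFinset, Set.mem_ofPred_eq] at h1 h2
    have := congrArg List.length (h1.1.2.trans h2.1.2.symm).forest_eq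
    simp only [Finset.coe_range, Set.mem_Iio] at hi hj
    simp only [List.length_take] at this
    omega

theorem ncard_copies_nil_notMem {L R : PlaneTree} (hL : L.IsBinary) (hR : R.IsBinary)
    (F : List PlaneTree) :
    {U ∈ (node [L, R]).copies F | [] ∉ U}.ncard = splitCount L R F := by
  have h : {U ∈ (node [L, R]).copies F | [] ∉ U} =
      (fun x : Set (List ℕ) × Set (List ℕ) => join x.1 x.2) '' copyPairs L R F := by
    ext U
    constructor
    · rintro ⟨⟨hU, h⟩, h0⟩
      obtain ⟨V, W, hV, hW, rfl⟩ := exists_eq_join hU h0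
      exact ⟨(V, W), ⟨hV, hW, h⟩, rfl⟩
    · rintro ⟨⟨V, W⟩, ⟨hV, hW, h⟩, rfl⟩
      exact ⟨⟨join_subset_vertices hV hW, h⟩, nil_notMem_join V W⟩
  rw [h, Set.ncard_image_of_injective, ncard_copyPairs hL hR]
  rintro ⟨V, W⟩ ⟨V', W'⟩ h
  exact Prod.ext (join_inj h).1 (join_inj h).2

theorem ncard_copies_nil_mem {L R : PlaneTree} (hL : L.IsBinary) (hR : R.IsBinary)
    (F : List PlaneTree) :
    {U ∈ (node [L, R]).copies [node F] | [] ∈ U}.ncard = splitCount L R F := by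
  have h : {U ∈ (node [L, R]).copies [node F] | [] ∈ U} =
      (fun x : Set (List ℕ) × Set (List ℕ) => insert [] (join x.1 x.2)) '' copyPairs L R F := by
    ext U
    constructor
    · rintro ⟨⟨hU, h⟩, h0⟩
      obtain ⟨V, W, hV, hW, rfl⟩ := exists_eq_insert_join hU h0
      obtain ⟨G, hG⟩ := (IsBinary.branch L R hL hR).exists_sameShape _
        (join_subset_vertices hV hW)
      have hGF := (h.trans (hG.insert_root (nil_notMem_join V W)).symm).forest_eq
      rw [List.cons.injEq, node.injEq] at hGF
      exact ⟨(V, W), ⟨hV, hW, hGF.1 ▸ hG⟩, rfl⟩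
    · rintro ⟨⟨V, W⟩, ⟨hV, hW, h⟩, rfl⟩
      exact ⟨⟨insert_join_subset_vertices hV hW, h.insert_root (nil_notMem_join V W)⟩,
        Set.mem_insert _ _⟩
  rw [h, Set.ncard_image_of_injective, ncard_copyPairs hL hR]
  rintro ⟨V, W⟩ ⟨V', W'⟩ h
  have hj : join V W = join V' W' := by
    simpa [Set.insert_sdiff_self_of_notMem, nil_notMem_join] using congrArg (· \ {[]}) h
  exact Prod.ext (join_inj hj).1 (join_inj hj).2

/-- A set that contains the root of the ambient tree has a greatest element, so its shape is a
single tree. -/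
theorem copies_nil_mem_eq_empty {L R : PlaneTree} (hL : L.IsBinary) (hR : R.IsBinary)
    {F : List PlaneTree} (hF : F.length ≠ 1) :
    {U ∈ (node [L, R]).copies F | [] ∈ U} = ∅ := by
  refine Set.eq_empty_of_forall_notMem ?_
  rintro U ⟨⟨hU, h⟩, h0⟩
  obtain ⟨V, W, hV, hW, rfl⟩ := exists_eq_insert_join hU h0
  obtain ⟨G, hG⟩ := (IsBinary.branch L R hL hR).exists_sameShape _ (join_subset_vertices hV hW)
  exact hF (congrArg List.length (h.trans (hG.insert_root (nil_notMem_join V W)).symm).forest_eq)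

theorem copyCount_pair_singleton {L R : PlaneTree} (hL : L.IsBinary) (hR : R.IsBinary)
    (F : List PlaneTree) :
    (node [L, R]).copyCount [node F] = splitCount L R [node F] + splitCount L R F := by
  rw [copyCount_eq_add, ncard_copies_nil_notMem hL hR, ncard_copies_nil_mem hL hR]

theorem copyCount_pair_of_length_ne {L R : PlaneTree} (hL : L.IsBinary) (hR : R.IsBinary)
    {F : List PlaneTree} (hF : F.length ≠ 1) :
    (node [L, R]).copyCount F = splitCount L R F := by
  rw [copyCount_eq_add, ncard_copies_nil_notMem hL hR, copies_nil_mem_eq_empty hL hR hF,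
    Set.ncard_empty, add_zero]

theorem numGoodEmbeddings_pair {L R : PlaneTree} (hL : L.IsBinary) (hR : R.IsBinary)
    (F : List PlaneTree) : numGoodEmbeddings (node [L, R]) (node F) = splitCount L R F := by
  rw [numGoodEmbeddings_eq, ncard_copies_nil_mem hL hR]

theorem copies_leaf_nil : (node []).copies [] = {∅} := by
  ext U
  simp only [copies, vertices_leaf, Set.subset_singleton_iff_eq, Set.mem_ofPred_eq,
    Set.mem_singleton_iff]
  constructor
  · rintro ⟨rfl | rfl, h⟩
    · rfl
    · exact absurd (h.trans sameShape_forestVertices_leaf.symm).forest_eq (List.cons_ne_nil _ _).symm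
  · rintro rfl
    exact ⟨Or.inl rfl, sameShape_forestVertices_nil⟩

theorem copies_leaf_leaf : (node []).copies [node []] = {{[]}} := by
  ext U
  simp only [copies, vertices_leaf, Set.subset_singleton_iff_eq, Set.mem_ofPred_eq,
    Set.mem_singleton_iff]
  constructor
  · rintro ⟨rfl | rfl, h⟩
    · exact absurd (h.trans sameShape_forestVertices_nil.symm).forest_eq (List.cons_ne_nil _ _)
    · rfl
  · rintro rfl
    exact ⟨Or.inr rfl, sameShape_forestVertices_leaf⟩

theorem copies_leaf_eq_empty {F : List PlaneTree} (h1 : F ≠ []) (h2 : F ≠ [node []]) :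
    (node []).copies F = ∅ := by
  refine Set.eq_empty_of_forall_notMem ?_
  rintro U ⟨hU, h⟩
  rw [vertices_leaf, Set.subset_singleton_iff_eq] at hU
  rcases hU with rfl | rfl
  · exact h1 (h.trans sameShape_forestVertices_nil.symm).forest_eq
  · exact h2 (h.trans sameShape_forestVertices_leaf.symm).forest_eq

theorem copyCount_leaf_nil : (node []).copyCount [] = 1 := by
  rw [copyCount, copies_leaf_nil, Set.ncard_singleton]

theorem copyCount_leaf_leaf : (node []).copyCount [node []] = 1 := by
  rw [copyCount, copies_leaf_leaf, Set.ncard_singleton]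

theorem copyCount_leaf_eq_zero {F : List PlaneTree} (h1 : F ≠ []) (h2 : F ≠ [node []]) :
    (node []).copyCount F = 0 := by
  rw [copyCount, copies_leaf_eq_empty h1 h2, Set.ncard_empty]

theorem numGoodEmbeddings_leaf_leaf : numGoodEmbeddings (node []) (node []) = 1 := by
  rw [numGoodEmbeddings_eq, copies_leaf_leaf, Set.ncard_eq_one]
  exact ⟨{[]}, by ext U; simp +contextual⟩

theorem numGoodEmbeddings_leaf_eq_zero {F : List PlaneTree} (h : F ≠ []) :
    numGoodEmbeddings (node []) (node F) = 0 := by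
  rw [numGoodEmbeddings_eq, copies_leaf_eq_empty (List.cons_ne_nil _ _) (by simpa using h)]
  simp

end PlaneTree

/-! ### Generating functions and their functional equations -/

namespace PlaneTree

open PowerSeries Finset

/-- Add the leaves to the tree of internal vertices of a plane binary tree. -/
def ofBinaryTree : BinaryTree Unit → PlaneTree
  | .nil => node []
  | .node _ L R => node [ofBinaryTree L, ofBinaryTree R]

theorem isBinary_ofBinaryTree (t : BinaryTree Unit) : (ofBinaryTree t).IsBinary := by
  induction t with
  | nil => exact IsBinary.leaf
  | node _ L R hL hR => exact IsBinary.branch _ _ hL hR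

theorem size_ofBinaryTree (t : BinaryTree Unit) :
    (ofBinaryTree t).size = 2 * t.numNodes + 1 := by
  induction t with
  | nil => simp [ofBinaryTree, size_node]
  | node _ L R hL hR =>
    simp only [ofBinaryTree, size_node, List.map_cons, List.map_nil, List.sum_cons, List.sum_nil,
      hL, hR, BinaryTree.numNodes]
    ring

theorem ofBinaryTree_injective : Function.Injective ofBinaryTree := by
  intro s
  induction s with
  | nil =>
    intro t h
    cases t with
    | nil => rfl
    | node _ L R => simp [ofBinaryTree] at h
  | node _ L R hL hR =>
    intro t h
    cases t with
    | nil => simp [ofBinaryTree] at h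
    | node _ L' R' =>
      simp only [ofBinaryTree, node.injEq, List.cons.injEq, and_true] at h
      rw [hL h.1, hR h.2]

theorem IsBinary.exists_ofBinaryTree {T : PlaneTree} (hT : T.IsBinary) :
    ∃ t, ofBinaryTree t = T := by
  induction hT with
  | leaf => exact ⟨.nil, rfl⟩
  | branch L R _ _ hL hR =>
    obtain ⟨l, rfl⟩ := hL
    obtain ⟨r, rfl⟩ := hR
    exact ⟨.node () l r, rfl⟩

theorem binaryTrees_eq_map (n : ℕ) :
    binaryTrees (2 * n + 1) =
      (BinaryTree.treesOfNumNodesEq n).map ⟨ofBinaryTree, ofBinaryTree_injective⟩ := by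
  ext T
  simp only [binaryTrees, Set.Finite.mem_toFinset, Set.mem_ofPred_eq, Finset.mem_map,
    BinaryTree.mem_treesOfNumNodesEq, Function.Embedding.coeFn_mk]
  constructor
  · rintro ⟨hT, hs⟩
    obtain ⟨t, rfl⟩ := hT.exists_ofBinaryTree
    rw [size_ofBinaryTree] at hs
    exact ⟨t, by omega, rfl⟩
  · rintro ⟨t, rfl, rfl⟩
    exact ⟨isBinary_ofBinaryTree t, size_ofBinaryTree t⟩

theorem sum_treesOfNumNodesEq_succ {M : Type*} [AddCommMonoid M] (w : PlaneTree → M) (n : ℕ) :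
    ∑ t ∈ BinaryTree.treesOfNumNodesEq (n + 1), w (ofBinaryTree t) =
      ∑ ij ∈ antidiagonal n, ∑ l ∈ BinaryTree.treesOfNumNodesEq ij.1,
        ∑ r ∈ BinaryTree.treesOfNumNodesEq ij.2, w (node [ofBinaryTree l, ofBinaryTree r]) := by
  rw [BinaryTree.treesOfNumNodesEq_succ, sum_biUnion]
  · refine sum_congr rfl fun ij _ => ?_
    rw [sum_map, sum_product]
    rfl
  · intro ij _ ij' _ hne
    rw [Function.onFun, Finset.disjoint_left]
    rintro t h1 h2
    simp only [Finset.mem_map, mem_product, BinaryTree.mem_treesOfNumNodesEq] at h1 h2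
    obtain ⟨x, ⟨h1, h1'⟩, rfl⟩ := h1
    obtain ⟨y, ⟨h2, h2'⟩, h⟩ := h2
    obtain ⟨-, hl, hr⟩ := BinaryTree.node.inj h
    exact hne (Prod.ext (by rw [← h1, ← h2, hl]) (by rw [← h1', ← h2', hr]))

/-- The generating function, by the number of internal vertices, of a weight on the plane binary
trees. -/
noncomputable def weightSeries (w : PlaneTree → ℕ) : ℝ⟦X⟧ :=
  PowerSeries.mk fun n => ∑ t ∈ BinaryTree.treesOfNumNodesEq n, (w (ofBinaryTree t) : ℝ)

theorem coeff_weightSeries (w : PlaneTree → ℕ) (n : ℕ) :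
    coeff n (weightSeries w) = ((∑ T ∈ binaryTrees (2 * n + 1), w T : ℕ) : ℝ) := by
  rw [weightSeries, coeff_mk, binaryTrees_eq_map, sum_map, Nat.cast_sum]
  rfl

/-- The generating function of the number of copies of a forest. -/
noncomputable def copySeries (F : List PlaneTree) : ℝ⟦X⟧ := weightSeries fun T => T.copyCount F

/-- The generating function of the number of good embeddings of a tree. -/
noncomputable def goodSeries (S : PlaneTree) : ℝ⟦X⟧ := weightSeries fun T => T.numGoodEmbeddings S

/-- The generating function of the number of copies of a forest in a pair of binary trees. -/
noncomputable def splitSeries (F : List PlaneTree) : ℝ⟦X⟧ :=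
  ∑ i ∈ range (F.length + 1), copySeries (F.take i) * copySeries (F.drop i)

theorem coeff_splitSeries (F : List PlaneTree) (n : ℕ) :
    coeff n (splitSeries F) = ∑ ij ∈ antidiagonal n, ∑ l ∈ BinaryTree.treesOfNumNodesEq ij.1,
      ∑ r ∈ BinaryTree.treesOfNumNodesEq ij.2,
        (splitCount (ofBinaryTree l) (ofBinaryTree r) F : ℝ) := by
  simp only [splitSeries, splitCount, map_sum, PowerSeries.coeff_mul, copySeries, weightSeries,
    coeff_mk, sum_mul_sum, Nat.cast_sum, Nat.cast_mul]
  rw [sum_comm]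
  refine sum_congr rfl fun ij _ => ?_
  rw [sum_comm]
  refine sum_congr rfl fun l _ => ?_
  rw [sum_comm]

theorem coeff_zero_weightSeries (w : PlaneTree → ℕ) :
    coeff 0 (weightSeries w) = (w (node []) : ℝ) := by
  simp [weightSeries, ofBinaryTree]

theorem coeff_succ_weightSeries (w : PlaneTree → ℕ) (n : ℕ) :
    coeff (n + 1) (weightSeries w) = ∑ ij ∈ antidiagonal n,
      ∑ l ∈ BinaryTree.treesOfNumNodesEq ij.1, ∑ r ∈ BinaryTree.treesOfNumNodesEq ij.2,
        (w (node [ofBinaryTree l, ofBinaryTree r]) : ℝ) := by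
  rw [weightSeries, coeff_mk, sum_treesOfNumNodesEq_succ fun T => (w T : ℝ)]

/-- The constant is the contribution of the one-vertex tree; in all other trees the root is one more
internal vertex, whence the factor `X`. -/
theorem weightSeries_eq_of_split {w : PlaneTree → ℕ} {F : List PlaneTree}
    (h : ∀ L R : PlaneTree, L.IsBinary → R.IsBinary → w (node [L, R]) = splitCount L R F) :
    weightSeries w = C (w (node []) : ℝ) + X * splitSeries F := by
  ext n
  cases n with
  | zero => simp [coeff_zero_weightSeries]
  | succ n =>
    rw [coeff_succ_weightSeries, map_add, coeff_succ_C, zero_add, coeff_succ_X_mul,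
      coeff_splitSeries]
    simp only [h _ _ (isBinary_ofBinaryTree _) (isBinary_ofBinaryTree _)]

theorem copySeries_of_length_ne {F : List PlaneTree} (hF : F.length ≠ 1) :
    copySeries F = C ((node []).copyCount F : ℝ) + X * splitSeries F :=
  weightSeries_eq_of_split fun _ _ hL hR => copyCount_pair_of_length_ne hL hR hF

theorem goodSeries_node (F : List PlaneTree) :
    goodSeries (node F) = C ((node []).numGoodEmbeddings (node F) : ℝ) + X * splitSeries F :=
  weightSeries_eq_of_split fun _ _ hL hR => numGoodEmbeddings_pair hL hR F

theorem numGoodEmbeddings_leaf (F : List PlaneTree) :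
    numGoodEmbeddings (node []) (node F) = (node []).copyCount [node F] := by
  rcases eq_or_ne F [] with rfl | hF
  · rw [numGoodEmbeddings_leaf_leaf, copyCount_leaf_leaf]
  · rw [numGoodEmbeddings_leaf_eq_zero hF,
      copyCount_leaf_eq_zero (List.cons_ne_nil _ _) (by simpa using hF)]

theorem copySeries_singleton (S : PlaneTree) :
    copySeries [S] = goodSeries S + X * splitSeries [S] := by
  obtain ⟨F⟩ := S
  rw [goodSeries_node]
  ext n
  cases n with
  | zero => simp [copySeries, coeff_zero_weightSeries, numGoodEmbeddings_leaf]
  | succ n =>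
    rw [copySeries, coeff_succ_weightSeries, map_add, map_add, coeff_succ_C, zero_add,
      coeff_succ_X_mul, coeff_succ_X_mul, coeff_splitSeries, coeff_splitSeries,
      ← sum_add_distrib]
    refine sum_congr rfl fun ij _ => ?_
    rw [← sum_add_distrib]
    refine sum_congr rfl fun l _ => ?_
    rw [← sum_add_distrib]
    refine sum_congr rfl fun r _ => ?_
    rw [copyCount_pair_singleton (isBinary_ofBinaryTree _) (isBinary_ofBinaryTree _),
      Nat.cast_add, add_comm]

/-- The contribution to `splitSeries F` of the splittings into two nonempty forests. -/
noncomputable def properSplitSeries (F : List PlaneTree) : ℝ⟦X⟧ :=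
  ∑ i ∈ range (F.length - 1), copySeries (F.take (i + 1)) * copySeries (F.drop (i + 1))

theorem splitSeries_nil : splitSeries [] = copySeries [] ^ 2 := by
  simp [splitSeries, sq]

theorem splitSeries_of_ne_nil {F : List PlaneTree} (hF : F ≠ []) :
    splitSeries F = 2 * copySeries [] * copySeries F + properSplitSeries F := by
  obtain ⟨n, hn⟩ := Nat.exists_eq_succ_of_ne_zero (mt List.length_eq_zero_iff.1 hF)
  rw [splitSeries, properSplitSeries, sum_range_succ, hn, sum_range_succ', ← hn, List.take_zero,
    List.drop_zero, List.take_length, List.drop_length, hn, Nat.succ_sub_one]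
  ring

theorem properSplitSeries_singleton (S : PlaneTree) : properSplitSeries [S] = 0 := by
  simp [properSplitSeries]

/-- The empty forest has exactly one copy in each binary tree, so this is the Catalan equation. -/
theorem copySeries_nil : copySeries [] = 1 + X * copySeries [] ^ 2 := by
  rw [← splitSeries_nil, copySeries_of_length_ne (by simp), copyCount_leaf_nil, Nat.cast_one,
    map_one]

/-- Completing the square in the Catalan equation. -/
theorem one_sub_copySeries_nil : 1 - 2 * X * copySeries [] = oneSubFourPow (-1 / 2) := by
  refine eq_oneSubFourPow_neg_half ?_ (by simp)
  linear_combination -4 * X * copySeries_nil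

/-- The two splits with an empty side contribute `2X * copySeries [] * copySeries F`; moved to the
left, they leave the factor `1 - 2X * copySeries [] = √(1 - 4X)`. -/
theorem copySeries_mul_of_two_le {F : List PlaneTree} (hF : 2 ≤ F.length) :
    oneSubFourPow (-1 / 2) * copySeries F = X * properSplitSeries F := by
  have hF0 : F ≠ [] := by
    rintro rfl
    simp at hF
  have h := copySeries_of_length_ne (F := F) (by omega)
  rw [copyCount_leaf_eq_zero hF0 (by rintro rfl; simp at hF), Nat.cast_zero, map_zero,
    splitSeries_of_ne_nil hF0] at h
  rw [← one_sub_copySeries_nil]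
  linear_combination h

/-- A single tree has no proper splits, so only the copies through the root remain on the right.
This is the source of the `1 / √n`. -/
theorem copySeries_mul_singleton (S : PlaneTree) :
    oneSubFourPow (-1 / 2) * copySeries [S] = goodSeries S := by
  have h := copySeries_singleton S
  rw [splitSeries_of_ne_nil (List.cons_ne_nil _ _), properSplitSeries_singleton] at h
  rw [← one_sub_copySeries_nil]
  linear_combination h

theorem goodSeries_leaf : goodSeries (node []) = copySeries [] := by
  rw [goodSeries_node, numGoodEmbeddings_leaf_leaf, splitSeries_nil, Nat.cast_one, map_one]
  exact copySeries_nil.symm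

theorem goodSeries_of_ne_nil {F : List PlaneTree} (hF : F ≠ []) :
    goodSeries (node F) = X * splitSeries F := by
  rw [goodSeries_node, numGoodEmbeddings_leaf_eq_zero hF, Nat.cast_zero, map_zero, zero_add]

theorem goodSeries_unary (S : PlaneTree) :
    goodSeries (node [S]) = (1 - oneSubFourPow (-1 / 2)) * copySeries [S] := by
  rw [goodSeries_of_ne_nil (List.cons_ne_nil _ _), splitSeries_of_ne_nil (List.cons_ne_nil _ _),
    properSplitSeries_singleton, ← one_sub_copySeries_nil]
  ring

/-- Deleting the root from a good copy leaves a copy of `F`, and a copy of two or more trees never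
uses the root. -/
theorem goodSeries_of_two_le {F : List PlaneTree} (hF : 2 ≤ F.length) :
    goodSeries (node F) = copySeries F := by
  have hF0 : F ≠ [] := by
    rintro rfl
    simp at hF
  rw [goodSeries_of_ne_nil hF0, copySeries_of_length_ne (by omega),
    copyCount_leaf_eq_zero hF0 (by rintro rfl; simp at hF), Nat.cast_zero, map_zero, zero_add]

theorem oneSubFourPow_half_mul_neg_half :
    oneSubFourPow (1 / 2) * oneSubFourPow (-1 / 2) = 1 := by
  rw [← oneSubFourPow_add, ← oneSubFourPow_zero]
  norm_num

/-! ### Closed form of the generating functions -/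

/-- The exponent of `1 - √(1 - 4X)` in the generating function of `S`. -/
def lowExponent (S : PlaneTree) : ℕ := S.degreeCount 0 + S.degreeCount 1

/-- The exponent of `1 / √(1 - 4X)` in the generating function of `S`. -/
def highExponent (S : PlaneTree) : ℕ := S.size + S.degreeCount 0

theorem degreeCount_node (i : ℕ) (ts : List PlaneTree) :
    (node ts).degreeCount i =
      (if ts.length = i then 1 else 0) + (ts.map (degreeCount i)).sum := by
  rw [degreeCount]

theorem lowExponent_node (ts : List PlaneTree) :
    (node ts).lowExponent = (if ts.length ≤ 1 then 1 else 0) + (ts.map lowExponent).sum := by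
  have h : (ts.map lowExponent).sum =
      (ts.map (degreeCount 0)).sum + (ts.map (degreeCount 1)).sum := List.sum_map_add
  rw [h, lowExponent, degreeCount_node, degreeCount_node]
  split_ifs <;> omega

theorem highExponent_node (ts : List PlaneTree) :
    (node ts).highExponent = 1 + (if ts.length = 0 then 1 else 0) + (ts.map highExponent).sum := by
  have h : (ts.map highExponent).sum =
      (ts.map size).sum + (ts.map (degreeCount 0)).sum := List.sum_map_add
  rw [h, highExponent, degreeCount_node, size_node]
  omega

/-- The generating function of `F`, times `X / √(1 - 4X)`, is a positive multiple of the product of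
powers of `1 - √(1 - 4X)` and `1 / √(1 - 4X)` given by the exponents of the trees of `F`. -/
def HasClosedForm (F : List PlaneTree) : Prop :=
  ∃ a : ℝ, 0 < a ∧ oneSubFourPow (1 / 2) * (X * copySeries F) =
    C a * (1 - oneSubFourPow (-1 / 2)) ^ (F.map lowExponent).sum *
      oneSubFourPow (1 / 2) ^ (F.map highExponent).sum

/-- With the normalisation `X / √(1 - 4X)`, the series of a forest of at least two trees is the sum
over proper splits of the products of the series of the parts. The exponents are additive, so all
summands are multiples of the same series, and `a > 0` because a proper split exists. -/
theorem hasClosedForm_of_forall (F : List PlaneTree) (hF : F ≠ [])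
    (h : ∀ S ∈ F, HasClosedForm [S]) : HasClosedForm F := by
  induction hn : F.length using Nat.strong_induction_on generalizing F with
  | _ n ih =>
    subst hn
    match F, hF, h with
    | [S], _, h => exact h S (List.mem_singleton_self S)
    | S :: T :: F', _, h =>
      set F := S :: T :: F' with hFdef
      have hlen : 2 ≤ F.length := by simp [hFdef]
      have hsplit : ∀ i ∈ range (F.length - 1), ∃ a : ℝ, 0 < a ∧
          oneSubFourPow (1 / 2) * (X * copySeries (F.take (i + 1))) *
            (oneSubFourPow (1 / 2) * (X * copySeries (F.drop (i + 1)))) =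
          C a * (1 - oneSubFourPow (-1 / 2)) ^ (F.map lowExponent).sum *
            oneSubFourPow (1 / 2) ^ (F.map highExponent).sum := by
        intro i hi
        rw [Finset.mem_range] at hi
        have hd : F.drop (i + 1) ≠ [] := by
          rw [Ne, List.drop_eq_nil_iff]
          omega
        obtain ⟨a, ha, h1⟩ := ih _ (by rw [List.length_take]; omega) (F.take (i + 1))
          (by simp [hFdef]) (fun S hS => h S (List.mem_of_mem_take hS)) rfl
        obtain ⟨b, hb, h2⟩ := ih _ (by rw [List.length_drop]; omega) (F.drop (i + 1))
          hd (fun S hS => h S (List.mem_of_mem_drop hS)) rfl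
        refine ⟨a * b, mul_pos ha hb, ?_⟩
        have hs : ∀ g : PlaneTree → ℕ, (F.map g).sum =
            ((F.take (i + 1)).map g).sum + ((F.drop (i + 1)).map g).sum := fun g => by
          rw [← List.sum_append, ← List.map_append, List.take_append_drop]
        rw [h1, h2, hs lowExponent, hs highExponent, pow_add, pow_add, map_mul]
        ring
      choose! a ha h using hsplit
      refine ⟨∑ i ∈ range (F.length - 1), a i,
        sum_pos ha ⟨0, Finset.mem_range.2 (by omega)⟩, ?_⟩
      rw [map_sum, sum_mul, sum_mul, ← sum_congr rfl h]
      have h1 := copySeries_mul_of_two_le hlen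
      have h2 : ∑ i ∈ range (F.length - 1),
          oneSubFourPow (1 / 2) * (X * copySeries (F.take (i + 1))) *
            (oneSubFourPow (1 / 2) * (X * copySeries (F.drop (i + 1)))) =
          oneSubFourPow (1 / 2) ^ 2 * X ^ 2 * properSplitSeries F := by
        rw [properSplitSeries, mul_sum]
        exact sum_congr rfl fun i _ => by ring
      rw [h2]
      linear_combination oneSubFourPow (1 / 2) ^ 2 * X * h1 -
        oneSubFourPow (1 / 2) * X * copySeries F * oneSubFourPow_half_mul_neg_half

/-- With `s = √(1 - 4X)`: a leaf gives `(1 - s) / (2 s^2)`, a root over one tree multiplies by `(1 -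
s) / s`, and a root over several trees multiplies by `1 / s`. -/
theorem hasClosedForm_singleton : ∀ S : PlaneTree, HasClosedForm [S]
  | node ts => by
    have ih : ∀ S ∈ ts, HasClosedForm [S] := fun S hS => hasClosedForm_singleton S
    have h0 := copySeries_mul_singleton (node ts)
    have h1 := oneSubFourPow_half_mul_neg_half
    simp only [HasClosedForm, List.map_cons, List.map_nil, List.sum_cons, List.sum_nil, add_zero]
      at ih ⊢
    rw [lowExponent_node, highExponent_node]
    match ts, ih, h0 with
    | [], _, h0 =>
      rw [goodSeries_leaf] at h0
      have h2 : (C (1 / 2 : ℝ)) * 2 = 1 := by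
        rw [← map_ofNat C 2, ← map_mul]
        norm_num
      refine ⟨1 / 2, by norm_num, ?_⟩
      simp only [List.length_nil, zero_le, if_true, List.map_nil, List.sum_nil]
      rw [← one_sub_copySeries_nil] at h0 h1 ⊢
      linear_combination oneSubFourPow (1 / 2) ^ 2 * X * h0 -
        oneSubFourPow (1 / 2) ^ 2 * X * copySeries [] * h2 -
        oneSubFourPow (1 / 2) * X * copySeries [node []] * h1
    | [S], ih, h0 =>
      obtain ⟨a, ha, hS⟩ := ih S (List.mem_singleton_self S)
      rw [goodSeries_unary] at h0
      refine ⟨a, ha, ?_⟩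
      simp only [List.length_singleton, le_refl, if_true, one_ne_zero, if_false, List.map_cons,
        List.map_nil, List.sum_cons, List.sum_nil, add_zero, pow_add, pow_one]
      linear_combination oneSubFourPow (1 / 2) ^ 2 * X * h0 +
        oneSubFourPow (1 / 2) * (1 - oneSubFourPow (-1 / 2)) * hS -
        oneSubFourPow (1 / 2) * X * copySeries [node [S]] * h1
    | S :: T :: F, ih, h0 =>
      obtain ⟨a, ha, hF⟩ := hasClosedForm_of_forall (S :: T :: F) (List.cons_ne_nil _ _)
        (fun S hS => hasClosedForm_singleton S)
      have hlen : 2 ≤ (S :: T :: F).length := by simp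
      rw [goodSeries_of_two_le hlen] at h0
      refine ⟨a, ha, ?_⟩
      rw [if_neg (by omega), if_neg (by omega), zero_add, add_zero, pow_add, pow_one]
      linear_combination oneSubFourPow (1 / 2) ^ 2 * X * h0 + oneSubFourPow (1 / 2) * hF -
        oneSubFourPow (1 / 2) * X * copySeries [node (S :: T :: F)] * h1
termination_by S => sizeOf S
decreasing_by
  all_goals
    have := List.sizeOf_lt_of_mem hS
    simp only [node.sizeOf_spec] at this ⊢
    omega

end PlaneTree

/-! ### The one-vertex case, the limit of the ratio, and the theorem -/

namespace PlaneTree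

open PowerSeries

theorem one_le_degreeCount_zero : ∀ S : PlaneTree, 1 ≤ S.degreeCount 0
  | node [] => by simp [degreeCount_node]
  | node (S :: ts) => by
    have := one_le_degreeCount_zero S
    rw [degreeCount_node, List.map_cons, List.sum_cons]
    omega

theorem one_le_size : ∀ S : PlaneTree, 1 ≤ S.size
  | node ts => by
    rw [size_node]
    omega

theorem eq_leaf_of_size_eq_one {S : PlaneTree} (h : S.size = 1) : S = node [] := by
  obtain ⟨_ | ⟨T, ts⟩⟩ := S
  · rfl
  · have := one_le_size T
    rw [size_node, List.map_cons, List.sum_cons] at h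
    omega

theorem IsBinary.copyCount_nil {T : PlaneTree} (hT : T.IsBinary) : T.copyCount [] = 1 := by
  induction hT with
  | leaf => exact copyCount_leaf_nil
  | branch L R hL hR ihL ihR =>
    rw [copyCount_pair_of_length_ne hL hR (by simp)]
    simp [splitCount, ihL, ihR]

theorem IsBinary.numEmbeddings_leaf {T : PlaneTree} (hT : T.IsBinary) :
    numEmbeddings T (node []) = T.size := by
  rw [numEmbeddings_eq]
  induction hT with
  | leaf => simp [copyCount_leaf_leaf, size_node]
  | branch L R hL hR ihL ihR =>
    rw [copyCount_pair_singleton hL hR]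
    simp [splitCount, Finset.sum_range_succ, ihL, ihR, hL.copyCount_nil, hR.copyCount_nil,
      size_node]
    ring

theorem IsBinary.numGoodEmbeddings_leaf {T : PlaneTree} (hT : T.IsBinary) :
    numGoodEmbeddings T (node []) = 1 := by
  cases hT with
  | leaf => exact numGoodEmbeddings_leaf_leaf
  | branch L R hL hR =>
    simp [numGoodEmbeddings_pair hL hR, splitCount, hL.copyCount_nil, hR.copyCount_nil]

theorem goodCount_leaf (n : ℕ) : goodCount n (node []) = (binaryTrees n).card := by
  rw [goodCount, Finset.card_eq_sum_ones]
  refine Finset.sum_congr rfl fun T hT => IsBinary.numGoodEmbeddings_leaf ?_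
  exact ((finite_binary n).mem_toFinset.1 hT).1

theorem allCount_leaf (n : ℕ) : allCount n (node []) = (binaryTrees n).card * n := by
  rw [allCount, ← smul_eq_mul, ← Finset.sum_const]
  refine Finset.sum_congr rfl fun T hT => ?_
  obtain ⟨hT, hs⟩ := (finite_binary n).mem_toFinset.1 hT
  rw [hT.numEmbeddings_leaf, hs]

theorem card_binaryTrees (n : ℕ) : (binaryTrees (2 * n + 1)).card = catalan n := by
  rw [binaryTrees_eq_map, Finset.card_map, BinaryTree.treesOfNumNodesEq_card_eq_catalan]

theorem card_binaryTrees_pos {n : ℕ} (hn : Odd n) : 0 < (binaryTrees n).card := by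
  obtain ⟨k, rfl⟩ := hn
  rw [card_binaryTrees, catalan_eq_centralBinom_div]
  exact Nat.div_pos (Nat.le_of_dvd k.centralBinom_pos k.succ_dvd_centralBinom) k.succ_pos

theorem coeff_goodSeries (S : PlaneTree) (n : ℕ) :
    coeff n (goodSeries S) = (goodCount (2 * n + 1) S : ℝ) :=
  coeff_weightSeries _ n

theorem coeff_copySeries_singleton (S : PlaneTree) (n : ℕ) :
    coeff n (copySeries [S]) = (allCount (2 * n + 1) S : ℝ) := by
  rw [copySeries, coeff_weightSeries, allCount]
  simp only [numEmbeddings_eq]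

/-- Both generating functions of `S` in closed form. -/
theorem exists_closedForm (S : PlaneTree) (k : ℝ)
    (hk : k = ((S.size : ℝ) + (S.degreeCount 0 : ℝ) - 2) / 2) :
    ∃ a : ℝ, 0 < a ∧
      X * goodSeries S =
        C a * ((1 - oneSubFourPow (-1 / 2)) ^ S.lowExponent * oneSubFourPow k) ∧
      X * copySeries [S] =
        C a * ((1 - oneSubFourPow (-1 / 2)) ^ S.lowExponent * oneSubFourPow (k + 1 / 2)) := by
  obtain ⟨a, ha, h⟩ := hasClosedForm_singleton S
  simp only [List.map_cons, List.map_nil, List.sum_cons, List.sum_nil, add_zero,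
    oneSubFourPow_half_pow] at h
  -- The exponent of `1 / √(1 - 4X)` is `m + l = 2k + 2`. Clearing the normalising factor lowers it
  -- by one for all embeddings, and by one more for good ones.
  have hexp : ((S.highExponent : ℕ) : ℝ) / 2 = k + 1 := by
    rw [highExponent, hk]
    push_cast
    ring
  rw [hexp] at h
  have h1 : oneSubFourPow (k + 1) * oneSubFourPow (-1 / 2) = oneSubFourPow (k + 1 / 2) := by
    rw [← oneSubFourPow_add]
    ring_nf
  have h2 : oneSubFourPow (k + 1 / 2) * oneSubFourPow (-1 / 2) = oneSubFourPow k := by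
    rw [← oneSubFourPow_add]
    ring_nf
  have hall : X * copySeries [S] =
      C a * ((1 - oneSubFourPow (-1 / 2)) ^ S.lowExponent * oneSubFourPow (k + 1 / 2)) := by
    linear_combination oneSubFourPow (-1 / 2) * h - X * copySeries [S] *
      oneSubFourPow_half_mul_neg_half +
      C a * (1 - oneSubFourPow (-1 / 2)) ^ S.lowExponent * h1
  refine ⟨a, ha, ?_, hall⟩
  linear_combination oneSubFourPow (-1 / 2) * hall - X * copySeries_mul_singleton S +
    C a * (1 - oneSubFourPow (-1 / 2)) ^ S.lowExponent * h2

/-- The ratio of good to all embeddings, scaled by the square root of the number of leaves. -/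
theorem tendsto_ratio_mul_sqrt (S : PlaneTree) (k : ℝ)
    (hk : k = ((S.size : ℝ) + (S.degreeCount 0 : ℝ) - 2) / 2) (hk0 : 0 < k) :
    Tendsto (fun n : ℕ => (goodCount (2 * n + 1) S : ℝ) / (allCount (2 * n + 1) S : ℝ) *
      √((n : ℝ) + 1)) atTop (𝓝 (Real.Gamma (k + 1 / 2) / Real.Gamma k)) := by
  obtain ⟨a, ha, hg, hall⟩ := exists_closedForm S k hk
  have h := (tendsto_coeff_mul_oneSubFourPow S.lowExponent k).div
    (tendsto_coeff_mul_oneSubFourPow S.lowExponent (k + 1 / 2))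
    (inv_ne_zero (Real.Gamma_pos_of_pos (by linarith)).ne')
  rw [inv_div_inv] at h
  -- The closed forms are for `X` times the series, so index `n + 1` is needed; the constant `a` and
  -- the power of `4` cancel in the ratio.
  refine (h.comp (tendsto_add_atTop_nat 1)).congr fun n => ?_
  have hn : (0 : ℝ) < ((n + 1 : ℕ) : ℝ) := Nat.cast_pos.2 n.succ_pos
  have hpow : ((n + 1 : ℕ) : ℝ) ^ (1 - k) =
      √((n + 1 : ℕ) : ℝ) * ((n + 1 : ℕ) : ℝ) ^ (1 - (k + 1 / 2)) := by
    rw [Real.sqrt_eq_rpow, ← Real.rpow_add hn]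
    ring_nf
  have hp := (Real.rpow_pos_of_pos hn (1 - (k + 1 / 2))).ne'
  rw [← coeff_goodSeries, ← coeff_copySeries_singleton, ← coeff_succ_X_mul n (goodSeries S),
    ← coeff_succ_X_mul n (copySeries [S]), hg, hall, coeff_C_mul, coeff_C_mul,
    mul_div_mul_left _ _ ha.ne']
  simp only [Function.comp_apply, Pi.div_apply]
  rw [hpow, ← mul_assoc, mul_div_mul_right _ _ hp, mul_div_right_comm,
    div_div_div_cancel_right₀ (by positivity)]
  push_cast
  rfl

theorem tendsto_sqrt_odd_div :
    Tendsto (fun n : ℕ => √((2 * n + 1 : ℕ) : ℝ) / (√2 * √((n : ℝ) + 1))) atTop (𝓝 1) := by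
  have h : Tendsto (fun n : ℕ => 1 - 1 / 2 * (1 / ((n : ℝ) + 1))) atTop (𝓝 1) := by
    have := ((tendsto_one_div_add_atTop_nhds_zero_nat (𝕜 := ℝ)).const_mul (1 / 2)).const_sub 1
    rwa [mul_zero, sub_zero] at this
  have h' := (Real.continuous_sqrt.tendsto 1).comp h
  rw [Real.sqrt_one] at h'
  refine h'.congr fun n => ?_
  rw [← Real.sqrt_mul (by norm_num), ← Real.sqrt_div (by positivity), Function.comp_apply]
  congr 1
  push_cast
  field_simp
  ring

/-- Reduces limits along odd numbers to limits in the number of internal vertices. -/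
theorem atTop_inf_odd_le : atTop ⊓ 𝓟 {n : ℕ | Odd n} ≤ map (fun n : ℕ => 2 * n + 1) atTop := by
  intro s hs
  obtain ⟨N, hN⟩ := mem_atTop_sets.1 (mem_map.1 hs)
  rw [mem_inf_principal]
  filter_upwards [eventually_ge_atTop (2 * N + 1)] with n hn
  rintro ⟨k, rfl⟩
  exact hN k (by omega)

theorem isEquivalent_ratio (S : PlaneTree) (k : ℝ)
    (hk : k = ((S.size : ℝ) + (S.degreeCount 0 : ℝ) - 2) / 2) (hk0 : 0 < k) :
    (fun n : ℕ => (goodCount n S : ℝ) / (allCount n S : ℝ)) ~[atTop ⊓ 𝓟 {n : ℕ | Odd n}]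
      fun n : ℕ => Real.Gamma (k + 1 / 2) / Real.Gamma k * (√2 / √(n : ℝ)) := by
  have hG : Real.Gamma (k + 1 / 2) / Real.Gamma k ≠ 0 :=
    (div_pos (Real.Gamma_pos_of_pos (by linarith)) (Real.Gamma_pos_of_pos hk0)).ne'
  refine isEquivalent_of_tendsto_one (Tendsto.mono_left ?_ atTop_inf_odd_le)
  rw [tendsto_map'_iff]
  have h := ((tendsto_ratio_mul_sqrt S k hk hk0).div_const
    (Real.Gamma (k + 1 / 2) / Real.Gamma k)).mul tendsto_sqrt_odd_div
  rw [div_self hG, mul_one] at h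
  refine h.congr fun n => ?_
  have h1 : √((n : ℝ) + 1) ≠ 0 := by positivity
  have h2 : √((2 * n + 1 : ℕ) : ℝ) ≠ 0 := by positivity
  simp only [Function.comp_apply, Pi.div_apply]
  generalize (goodCount (2 * n + 1) S : ℝ) / (allCount (2 * n + 1) S : ℝ) = r
  field_simp

end PlaneTree

theorem mainTheorem4 (S : PlaneTree) (m l : ℕ) (hm : m = S.size) (hl : l = S.degreeCount 0)
    (k : ℝ) (hk : k = ((m : ℝ) + (l : ℝ) - 2) / 2) :
    (0 < k →
      ((fun n : ℕ => (PlaneTree.goodCount n S : ℝ) / (PlaneTree.allCount n S : ℝ))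
          ~[atTop ⊓ 𝓟 {n : ℕ | Odd n}]
        fun n : ℕ => Real.Gamma (k + 1 / 2) / Real.Gamma k * (√2 / √(n : ℝ))) ∧
      ((fun n : ℕ => (PlaneTree.goodCount n S : ℝ) / (PlaneTree.allCount n S : ℝ))
          =Θ[atTop ⊓ 𝓟 {n : ℕ | Odd n}]
        fun n : ℕ => 1 / √(n : ℝ))) ∧
    (k = 0 →
      (fun n : ℕ => (PlaneTree.goodCount n S : ℝ) / (PlaneTree.allCount n S : ℝ))
          ~[atTop ⊓ 𝓟 {n : ℕ | Odd n}]
        fun n : ℕ => 1 / (n : ℝ)) := by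
  subst hm hl
  refine ⟨fun hk0 => ?_, fun hk0 => ?_⟩
  · have h := PlaneTree.isEquivalent_ratio S k hk hk0
    refine ⟨h, h.isTheta.trans ?_⟩
    have hc : Real.Gamma (k + 1 / 2) / Real.Gamma k * √2 ≠ 0 :=
      (mul_pos (div_pos (Real.Gamma_pos_of_pos (by linarith)) (Real.Gamma_pos_of_pos hk0))
        (by positivity)).ne'
    have h' := (isTheta_const_mul_left (l := atTop ⊓ 𝓟 {n : ℕ | Odd n}) hc).2
      (isTheta_refl (fun n : ℕ => 1 / √(n : ℝ)) _)
    simpa only [mul_one_div, mul_div_assoc] using h'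
  · have h1 := S.one_le_size
    have h2 := S.one_le_degreeCount_zero
    -- Both summands are at least `1`, so `k = 0` leaves only the single vertex.
    have h3 : S.size + S.degreeCount 0 = 2 := by
      have : ((S.size + S.degreeCount 0 : ℕ) : ℝ) = (2 : ℕ) := by
        push_cast
        linarith
      exact_mod_cast this
    obtain rfl := PlaneTree.eq_leaf_of_size_eq_one (S := S) (by omega)
    -- Here the ratio equals `1 / n` for every odd `n`; oddness makes the family nonempty, so that
    -- its cardinality cancels.
    refine EventuallyEq.isEquivalent (mem_inf_of_right fun n hn => ?_)
    have hc : ((PlaneTree.binaryTrees n).card : ℝ) ≠ 0 :=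
      Nat.cast_ne_zero.2 (PlaneTree.card_binaryTrees_pos hn).ne'
    show (PlaneTree.goodCount n _ : ℝ) / (PlaneTree.allCount n _ : ℝ) = 1 / (n : ℝ)
    rw [PlaneTree.goodCount_leaf, PlaneTree.allCount_leaf, Nat.cast_mul, ← div_div, div_self hc]
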